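/- Notation. Let $\mathbb T$ be the unit circle with normalized Lebesgue measure and $\mathbb D$ the open unit disk. For $p\in\{2,\infty\}$, $H^p$ is the space of $f\in L^p(\mathbb T)$ whose Fourier coefficients $\widehat f(k)$ vanish for all $k<0$; $H^p_{M_{n\times m}}$ is the space of $n\times m$ matrix functions on $\mathbb T$ with entries in $H^p$, and $H^p_{M_n}:=H^p_{M_{n\times n}}$. Functions are identified when they agree almost everywhere on $\mathbb T$. For $\alpha\in\mathbb D$, the value $f(\alpha):=\sum_{k\ge 0}\widehat f(k)\alpha^k$ of $f\in H^2$ is that of its analytic extension to $\mathbb D$, taken entrywise for matrix functions. For a matrix function $\Phi$ put $\widetilde\Phi(z):=\Phi(\overline z)^*$. A matrix function $\Delta\in H^\infty_{M_{n\times m}}$ is inner if $\Delta(z)^*\Delta(z)=I_m$ for almost all $z\in\mathbb T$. An inner $\Delta\in H^\infty_{M_{n\times m}}$ with $m\le n$ is a left inner divisor of $\Phi\in H^2_{M_{n\times r}}$ if $\Phi=\Delta A$ for some $A\in H^2_{M_{m\times r}}$. Two matrix functions $\Phi\in H^2_{M_{n\times r}}$ and $\Psi\in H^2_{M_{n\times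 s}}$ are left coprime if every common left inner divisor of $\Phi$ and $\Psi$ is a (square) unitary constant matrix; $\Phi\in H^2_{M_{n\times r}}$ and $\Psi\in H^2_{M_{m\times r}}$ are right coprime if $\widetilde\Phi$ and $\widetilde\Psi$ are left coprime. A finite Blaschke product is a function $\theta(z)=\nu\prod_{j=1}^N\frac{z-a_j}{1-\overline{a_j}z}$ with $N\ge 0$, $|\nu|=1$ and $a_1,\dots,a_N\in\mathbb D$ (repetitions allowed), and $\mathcal Z(\theta)\subset\mathbb D$ is its set of zeros. Lemma 3.12. Let $B\in H^2_{M_n}$ and let $\Theta:=\theta I_n$ with a finite Blaschke product $\theta$. Then the following statements are equivalent: (a) $B(\alpha)$ is invertible for each $\alpha\in\mathcal Z(\theta)$; (b) $B$ and $\Theta$ are right coprime; (c) $B$ and $\Theta$ are left coprime. -/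

import Mathlib

open MeasureTheory AddCircle Matrix
open scoped ENNReal ComplexConjugate

noncomputable section

/-- The unit circle, parametrized by the angle: `t` stands for the point `toCircle t = e^{it}`. It
carries the normalized Haar measure `haarAddCircle`. -/
abbrev TorusT : Type := AddCircle (2 * Real.pi)

/-- The period `2π` is positive. -/
instance fact_two_pi_pos_torus : Fact (0 < 2 * Real.pi) := ⟨Real.two_pi_pos⟩

/-- `f ∈ H^p(𝕋)`: `f` belongs to `L^p(𝕋)` and its Fourier coefficients of negative index vanish.
Elements of `L^p` are represented by functions, which matter only up to null sets. -/
def MemHardy (p : ℝ≥0∞) (f : TorusT → ℂ) : Prop :=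
  MemLp f p haarAddCircle ∧ ∀ k : ℤ, k < 0 → fourierCoeff f k = 0

/-- The value at the point `α` of the open unit disk of (the analytic extension of) a function
of `H²(𝕋)`, that is, the sum of the power series `∑ k ≥ 0, f̂(k) α ^ k`. -/
def diskValue (f : TorusT → ℂ) (α : ℂ) : ℂ :=
  ∑' k : ℕ, fourierCoeff f (k : ℤ) * α ^ k

/-- The zeros, in the open unit disk, of (the analytic extension of) `f`. -/
def diskZeros (f : TorusT → ℂ) : Set ℂ :=
  {α : ℂ | ‖α‖ < 1 ∧ diskValue f α = 0}

/-- `θ` is a finite Blaschke product `ν ∏ (z - a_j) / (1 - conj a_j z)` with `|ν| = 1` and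
`|a_j| < 1`; the product may be empty and the `a_j` may repeat. -/
def IsFiniteBlaschkeProduct (θ : TorusT → ℂ) : Prop :=
  ∃ (N : ℕ) (ν : ℂ) (a : Fin N → ℂ), ‖ν‖ = 1 ∧ (∀ j, ‖a j‖ < 1) ∧
    ∀ᵐ t ∂(haarAddCircle : Measure TorusT),
      θ t = ν * ∏ j, (((toCircle t : Circle) : ℂ) - a j) /
        (1 - conj (a j) * ((toCircle t : Circle) : ℂ))

/-- Matrix-valued functions on the circle. -/
abbrev MatFun (n m : ℕ) : Type := TorusT → Matrix (Fin n) (Fin m) ℂ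

/-- `Φ ∈ H^p_{M_{n × m}} = H^p ⊗ M_{n × m}`. -/
def MemHardyMat {n m : ℕ} (p : ℝ≥0∞) (Φ : MatFun n m) : Prop :=
  ∀ i j, MemHardy p (fun t => Φ t i j)

/-- The value `Φ(α)` at a point `α` of the open unit disk. -/
def diskValueMat {n m : ℕ} (Φ : MatFun n m) (α : ℂ) : Matrix (Fin n) (Fin m) ℂ :=
  Matrix.of fun i j => diskValue (fun t => Φ t i j) α

/-- `Φ̃(z) = Φ(z̄)*`; complex conjugation on the circle is `t ↦ -t`. -/
def tildeMat {n m : ℕ} (Φ : MatFun n m) : MatFun m n :=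
  fun t => (Φ (-t))ᴴ

/-- Inner matrix functions: `Δ ∈ H^∞_{M_{n × m}}` and `Δ(z)* Δ(z) = I_m` for almost all `z`. -/
def IsInnerMat {n m : ℕ} (Δ : MatFun n m) : Prop :=
  MemHardyMat ∞ Δ ∧ ∀ᵐ t ∂(haarAddCircle : Measure TorusT), (Δ t)ᴴ * Δ t = 1

/-- `Δ` is a left inner divisor of `Φ`: it is an inner `n × m` function, `m ≤ n`, and `Φ = Δ A`
for some `A ∈ H²_{M_{m × r}}`. -/
def IsLeftInnerDivisor {n m r : ℕ} (Δ : MatFun n m) (Φ : MatFun n r) : Prop :=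
  m ≤ n ∧ IsInnerMat Δ ∧ ∃ A : MatFun m r, MemHardyMat 2 A ∧
    ∀ᵐ t ∂(haarAddCircle : Measure TorusT), Φ t = Δ t * A t

/-- `Δ` is (almost everywhere) equal to a constant unitary matrix. The two conditions on `U` force
`U` to be square. -/
def IsUnitaryConstant {n m : ℕ} (Δ : MatFun n m) : Prop :=
  ∃ U : Matrix (Fin n) (Fin m) ℂ, Uᴴ * U = 1 ∧ U * Uᴴ = 1 ∧
    ∀ᵐ t ∂(haarAddCircle : Measure TorusT), Δ t = U

/-- `Φ` and `Ψ` are left coprime: their only common left inner divisors are the unitary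
constants. -/
def LeftCoprimeMat {n r s : ℕ} (Φ : MatFun n r) (Ψ : MatFun n s) : Prop :=
  ∀ (m : ℕ) (Δ : MatFun n m),
    IsLeftInnerDivisor Δ Φ → IsLeftInnerDivisor Δ Ψ → IsUnitaryConstant Δ

/-- `Φ` and `Ψ` are right coprime: `Φ̃` and `Ψ̃` are left coprime. -/
def RightCoprimeMat {n m r : ℕ} (Φ : MatFun n r) (Ψ : MatFun m r) : Prop :=
  LeftCoprimeMat (tildeMat Φ) (tildeMat Ψ)

/-- The matrix function `θ I_n`. -/
def scalarMat (n : ℕ) (θ : TorusT → ℂ) : MatFun n n :=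
  fun t => θ t • (1 : Matrix (Fin n) (Fin n) ℂ)

end

/-! Everything rests on one division principle: if `f ∈ H²` vanishes at `a` in the disk and `b` is
the Blaschke factor of `a`, then `conj b * f`, which is `f / b` on the circle, is again in `H²`
(`MemHardy.conj_blaschkeFactor_mul`). It is proved from Fourier coefficients alone.

(c) ⇒ (a): if `B(α)` is singular at a zero `α` of `θ`, some orthogonal projection `P ≠ 0` satisfies
`P B(α) = 0`. The nonconstant inner function `b P + (1 - P)` then divides on the left every `Φ ∈ H²`
with `P Φ(α) = 0`, in particular both `B` and `θ I`.

(a) ⇒ (c): let `B = Δ C` and `θ I = Δ A`. Comparing ranks makes `Δ` square, and `Δ(a_j)` is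
invertible because `B(a_j)` is. Hence `A(a_j) = 0`, and the Blaschke factors can be divided out of
`A` one at a time until `Δ A' = ν I`. Since `Δ` is unitary on the circle, `Δ* = ν⁻¹ A'` is analytic
together with `Δ`, so `Δ` is constant.

(a) ⇔ (b): the tilde operation turns `θ` into a Blaschke product with conjugate zeros and `B(α)`
into `B(conj α)*`, so this is (a) ⇔ (c) for the transformed pair. -/

noncomputable section

/-! ### Fourier coefficients on the circle: convolution, bounds, shifts. -/

section FourierCoefficients

variable {f g : TorusT → ℂ} {p : ℝ≥0∞}

lemma fourierBasis_inner_toLp (hf : MemLp f 2 haarAddCircle) (i : ℤ) :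
    inner ℂ (fourierBasis (T := 2 * Real.pi) i) (hf.toLp f) = fourierCoeff f i := by
  rw [← HilbertBasis.repr_apply_apply, fourierBasis_repr, fourierCoeff_congr_ae hf.coeFn_toLp]

/-- The Fourier coefficients of a product of two square-integrable functions are given by
convolution. -/
lemma hasSum_fourierCoeff_mul (hf : MemLp f 2 haarAddCircle) (hg : MemLp g 2 haarAddCircle)
    (k : ℤ) :
    HasSum (fun j : ℤ => fourierCoeff f j * fourierCoeff g (k - j))
      (fourierCoeff (fun t => f t * g t) k) := by
  -- The function is chosen so that its inner product with `f` is the `k`-th coefficient of `f g`;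
  -- Parseval's identity then gives the convolution.
  have hG : MemLp (fun t => conj (fourier (-k) t * g t)) 2
      (haarAddCircle : Measure TorusT) := by
    refine MemLp.of_le hg ?_ (.of_forall fun t => ?_)
    · exact Complex.continuous_conj.comp_aestronglyMeasurable
        ((fourier (-k)).continuous.aestronglyMeasurable.mul hg.1)
    · simp [-fourier_apply, fourier_apply, Circle.norm_coe]
  have h := (fourierBasis (T := 2 * Real.pi)).hasSum_inner_mul_inner (hG.toLp _) (hf.toLp f)
  have h1 : inner ℂ (hG.toLp _) (hf.toLp f) = fourierCoeff (fun t => f t * g t) k := by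
    rw [L2.inner_def]
    refine integral_congr_ae ?_
    filter_upwards [hG.coeFn_toLp, hf.coeFn_toLp] with t h1 h2
    rw [h1, h2]
    simp only [RCLike.inner_apply', Complex.conj_conj, smul_eq_mul]
    ring
  rw [h1] at h
  suffices h2 : ∀ j : ℤ, inner ℂ (hG.toLp _) (fourierBasis (T := 2 * Real.pi) j) *
      inner ℂ (fourierBasis (T := 2 * Real.pi) j) (hf.toLp f) =
        fourierCoeff f j * fourierCoeff g (k - j) by
    simpa only [h2] using h
  intro j
  rw [fourierBasis_inner_toLp, ← inner_conj_symm, fourierBasis_inner_toLp, mul_comm]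
  congr 1
  simp only [fourierCoeff]
  rw [← integral_conj]
  refine integral_congr_ae (.of_forall fun t => ?_)
  simp only [smul_eq_mul, map_mul, ← fourier_neg, Complex.conj_conj]
  rw [← mul_assoc, ← fourier_add]
  congr 3
  ring

lemma norm_fourierCoeff_le (k : ℤ) :
    ‖fourierCoeff f k‖ ≤ ∫ t, ‖f t‖ ∂(haarAddCircle : Measure TorusT) := by
  refine (norm_integral_le_integral_norm _).trans_eq ?_
  refine integral_congr_ae (.of_forall fun t => ?_)
  simp only [norm_smul, fourier_apply, Circle.norm_coe, one_mul]

lemma summable_norm_fourierCoeff_mul_pow {α : ℂ} (hα : ‖α‖ < 1) :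
    Summable fun k : ℕ => ‖fourierCoeff f (k : ℤ) * α ^ k‖ := by
  refine Summable.of_nonneg_of_le (fun _ => norm_nonneg _) (fun k => ?_)
    ((summable_geometric_of_lt_one (norm_nonneg α) hα).mul_left
      (∫ t, ‖f t‖ ∂(haarAddCircle : Measure TorusT)))
  rw [norm_mul, norm_pow]
  gcongr
  exact norm_fourierCoeff_le _

lemma fourierCoeff_toCircle_mul (f : TorusT → ℂ) (k : ℤ) :
    fourierCoeff (fun t => (toCircle t : ℂ) * f t) k = fourierCoeff f (k - 1) := by
  simp only [fourierCoeff, smul_eq_mul]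
  congr 1
  funext t
  rw [← fourier_one, ← mul_assoc, ← fourier_add]
  congr 3
  ring

lemma integrable_toCircle_mul (hf : Integrable f haarAddCircle) :
    Integrable (fun t => (toCircle t : ℂ) * f t) haarAddCircle := by
  simpa using hf.fourier_smul 1

lemma fourierCoeff_add' (hf : Integrable f haarAddCircle) (hg : Integrable g haarAddCircle)
    (k : ℤ) :
    fourierCoeff (fun t => f t + g t) k = fourierCoeff f k + fourierCoeff g k :=
  congrFun (fourierCoeff.add hf hg) k

lemma fourierCoeff_toCircle_sub_mul (hf : Integrable f haarAddCircle) (a : ℂ) (k : ℤ) :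
    fourierCoeff (fun t => ((toCircle t : ℂ) - a) * f t) k =
      fourierCoeff f (k - 1) - a * fourierCoeff f k := by
  have h := fourierCoeff_add' (integrable_toCircle_mul hf) (hf.const_mul (-a)) k
  rw [fourierCoeff.const_mul, fourierCoeff_toCircle_mul] at h
  rw [sub_eq_add_neg, ← neg_mul, ← h]
  congr 1
  funext t
  ring

lemma fourierCoeff_one_sub_mul (hf : Integrable f haarAddCircle) (a : ℂ) (k : ℤ) :
    fourierCoeff (fun t => (1 - a * (toCircle t : ℂ)) * f t) k =
      fourierCoeff f k - a * fourierCoeff f (k - 1) := by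
  have h := fourierCoeff_add' hf ((integrable_toCircle_mul hf).const_mul (-a)) k
  rw [fourierCoeff.const_mul, fourierCoeff_toCircle_mul] at h
  rw [sub_eq_add_neg, ← neg_mul, ← h]
  congr 1
  funext t
  ring

/-- Conjugation and reflection of the variable conjugate the Fourier coefficients. -/
lemma fourierCoeff_conj_neg (f : TorusT → ℂ) (k : ℤ) :
    fourierCoeff (fun t => conj (f (-t))) k = conj (fourierCoeff f k) := by
  simp only [fourierCoeff]
  rw [← integral_conj, ← integral_neg_eq_self]
  congr 1
  funext t
  simp only [smul_eq_mul, map_mul, neg_neg, ← fourier_neg]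
  simp [fourier_apply]

/-- The value at `a` of `(z - a) h` is the coefficient of index `-1` of `h`. -/
lemma diskValue_toCircle_sub_mul (hf : Integrable f haarAddCircle) {a : ℂ} (ha : ‖a‖ < 1) :
    diskValue (fun t => ((toCircle t : ℂ) - a) * f t) a = fourierCoeff f (-1) := by
  have hs := (summable_norm_fourierCoeff_mul_pow
    (f := fun t => ((toCircle t : ℂ) - a) * f t) ha).of_norm.hasSum
  -- With `c` the coefficients of `f`, the terms `(c (k-1) - a * c k) * a ^ k` telescope to `c (-1)
  -- - c (n-1) * a ^ n`, and `c` is bounded.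
  refine tendsto_nhds_unique hs.tendsto_sum_nat ?_
  have h0 : Filter.Tendsto (fun n : ℕ => fourierCoeff f (n - 1 : ℤ) * a ^ n)
      Filter.atTop (nhds 0) := by
    refine squeeze_zero_norm (a := fun n =>
      (∫ t, ‖f t‖ ∂(haarAddCircle : Measure TorusT)) * ‖a‖ ^ n) (fun n => ?_) ?_
    · rw [norm_mul, norm_pow]
      gcongr
      exact norm_fourierCoeff_le _
    · simpa using (tendsto_pow_atTop_nhds_zero_of_lt_one (norm_nonneg a) ha).const_mul
        (∫ t, ‖f t‖ ∂(haarAddCircle : Measure TorusT))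
  have h1 := h0.const_sub (fourierCoeff f (-1))
  rw [sub_zero] at h1
  refine h1.congr fun n => ?_
  have h2 := Finset.sum_range_sub' (fun n : ℕ => fourierCoeff f (n - 1 : ℤ) * a ^ n) n
  simp only [Nat.cast_zero, zero_sub, pow_zero, mul_one] at h2
  rw [← h2]
  refine Finset.sum_congr rfl fun k _ => ?_
  rw [fourierCoeff_toCircle_sub_mul hf]
  push_cast
  rw [add_sub_cancel_right]
  ring

end FourierCoefficients

/-! ### Hardy functions: algebra, and evaluation in the disk. -/

section Hardy

variable {f g : TorusT → ℂ} {p : ℝ≥0∞}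

lemma MemHardy.two (hf : MemHardy ∞ f) : MemHardy 2 f :=
  ⟨hf.1.mono_exponent le_top, hf.2⟩

lemma MemHardy.integrable (hf : MemHardy 2 f) : Integrable f haarAddCircle :=
  hf.1.integrable (by norm_num)

lemma MemHardy.congr (hf : MemHardy p f) (h : f =ᵐ[haarAddCircle] g) : MemHardy p g :=
  ⟨(memLp_congr_ae h).1 hf.1, fourierCoeff_congr_ae h ▸ hf.2⟩

lemma diskValue_congr (h : f =ᵐ[haarAddCircle] g) : diskValue f = diskValue g := by
  funext α
  rw [diskValue, diskValue, fourierCoeff_congr_ae h]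

lemma fourierCoeff_const (c : ℂ) (k : ℤ) :
    fourierCoeff (fun _ : TorusT => c) k = if k = 0 then c else 0 := by
  have h := fourierCoeff.const_mul (fun t : TorusT => fourier 0 t) c k
  rw [fourierCoeff_fourier] at h
  simp only [fourier_zero, mul_one] at h
  rw [h]
  by_cases hk : k = 0 <;> simp [hk]

lemma memHardy_const (c : ℂ) : MemHardy p (fun _ => c) :=
  ⟨memLp_const c, fun k hk => by rw [fourierCoeff_const, if_neg hk.ne]⟩

lemma diskValue_const (c α : ℂ) : diskValue (fun _ => c) α = c := by
  rw [diskValue, tsum_eq_single 0]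
  · simp [fourierCoeff_const]
  · intro k hk
    simp [fourierCoeff_const, hk]

lemma MemHardy.const_mul (hf : MemHardy p f) (c : ℂ) : MemHardy p (fun t => c * f t) :=
  ⟨hf.1.const_mul c, fun k hk => by rw [fourierCoeff.const_mul, hf.2 k hk, mul_zero]⟩

lemma MemHardy.add (hp : 1 ≤ p) (hf : MemHardy p f) (hg : MemHardy p g) :
    MemHardy p (fun t => f t + g t) :=
  ⟨hf.1.add hg.1, fun k hk => by
    rw [fourierCoeff_add' (hf.1.integrable hp) (hg.1.integrable hp), hf.2 k hk, hg.2 k hk,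
      add_zero]⟩

lemma MemHardy.sum (hp : 1 ≤ p) {ι : Type*} (s : Finset ι) {F : ι → TorusT → ℂ}
    (hF : ∀ i ∈ s, MemHardy p (F i)) : MemHardy p (fun t => ∑ i ∈ s, F i t) := by
  classical
  induction s using Finset.induction_on with
  | empty => simpa using memHardy_const (p := p) 0
  | insert i s hi ih =>
    simp only [Finset.sum_insert hi]
    exact (hF i (by simp)).add hp (ih fun j hj => hF j (by simp [hj]))

lemma fourierCoeff_mul_of_neg (hf : MemHardy 2 f) (hg : MemHardy 2 g) {k : ℤ} (hk : k < 0) :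
    fourierCoeff (fun t => f t * g t) k = 0 := by
  refine (hasSum_fourierCoeff_mul hf.1 hg.1 k).unique ?_
  convert hasSum_zero with j
  rcases lt_or_ge j 0 with hj | hj
  · rw [hf.2 j hj, zero_mul]
  · rw [hg.2 _ (by omega), mul_zero]

lemma fourierCoeff_mul_nat (hf : MemHardy 2 f) (hg : MemHardy 2 g) (k : ℕ) :
    fourierCoeff (fun t => f t * g t) (k : ℤ) =
      ∑ p ∈ Finset.HasAntidiagonal.antidiagonal k, fourierCoeff f (p.1 : ℤ) * fourierCoeff g (p.2 : ℤ) := by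
  refine (hasSum_fourierCoeff_mul hf.1 hg.1 k).unique ?_
  rw [Finset.Nat.sum_antidiagonal_eq_sum_range_succ
    (fun i j => fourierCoeff f (i : ℤ) * fourierCoeff g (j : ℤ))]
  -- Only `0 ≤ j ≤ k` contributes: otherwise `j` or `k - j` is negative.
  have h := hasSum_sum_of_ne_finset_zero
    (f := fun j : ℤ => fourierCoeff f j * fourierCoeff g (k - j))
    (s := (Finset.range (k + 1)).map Nat.castEmbedding) (L := .unconditional ℤ) (by
      intro j hj
      rcases lt_or_ge j 0 with hj' | hj'
      · rw [hf.2 j hj', zero_mul]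
      · lift j to ℕ using hj'
        rw [hg.2 _ ?_, mul_zero]
        simp at hj
        omega)
  rw [Finset.sum_map] at h
  convert h using 1
  refine Finset.sum_congr rfl fun i hi => ?_
  rw [Finset.mem_range] at hi
  simp only [Nat.castEmbedding_apply]
  rw [Nat.cast_sub (by omega)]

lemma MemHardy.mul_bounded {q : ℝ≥0∞} (hq : 2 ≤ q) (hf : MemHardy ∞ f) (hg : MemHardy q g) :
    MemHardy q (fun t => f t * g t) :=
  ⟨hg.1.mul hf.1, fun _ hk =>
    fourierCoeff_mul_of_neg hf.two ⟨hg.1.mono_exponent hq, hg.2⟩ hk⟩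

lemma diskValue_mul (hf : MemHardy 2 f) (hg : MemHardy 2 g) {α : ℂ} (hα : ‖α‖ < 1) :
    diskValue (fun t => f t * g t) α = diskValue f α * diskValue g α := by
  simp only [diskValue]
  rw [tsum_mul_tsum_eq_tsum_sum_antidiagonal_of_summable_norm
    (summable_norm_fourierCoeff_mul_pow hα) (summable_norm_fourierCoeff_mul_pow hα)]
  refine tsum_congr fun k => ?_
  rw [fourierCoeff_mul_nat hf hg, Finset.sum_mul]
  refine Finset.sum_congr rfl fun p hp => ?_
  rw [← Finset.HasAntidiagonal.mem_antidiagonal.1 hp, pow_add]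
  ring

lemma diskValue_add (hf : Integrable f haarAddCircle) (hg : Integrable g haarAddCircle) {α : ℂ}
    (hα : ‖α‖ < 1) :
    diskValue (fun t => f t + g t) α = diskValue f α + diskValue g α := by
  simp only [diskValue]
  rw [← (summable_norm_fourierCoeff_mul_pow hα).of_norm.tsum_add
    (summable_norm_fourierCoeff_mul_pow hα).of_norm]
  simp only [fourierCoeff_add' hf hg, add_mul]

lemma diskValue_sum {ι : Type*} (s : Finset ι) {F : ι → TorusT → ℂ}
    (hF : ∀ i ∈ s, Integrable (F i) haarAddCircle) {α : ℂ} (hα : ‖α‖ < 1) :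
    diskValue (fun t => ∑ i ∈ s, F i t) α = ∑ i ∈ s, diskValue (F i) α := by
  classical
  induction s using Finset.induction_on with
  | empty => simpa using diskValue_const 0 α
  | insert i s hi ih =>
    simp only [Finset.sum_insert hi]
    rw [diskValue_add (hF i (by simp)) (integrable_finsetSum _ fun j hj => hF j (by simp [hj])) hα,
      ih fun j hj => hF j (by simp [hj])]

/-- A function which is analytic together with its conjugate is constant. -/
lemma MemHardy.ae_eq_const (hf : MemHardy 2 f) (hf' : MemHardy 2 (fun t => conj (f t))) :
    ∀ᵐ t ∂(haarAddCircle : Measure TorusT), f t = fourierCoeff f 0 := by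
  -- The coefficients of positive index are conjugates of coefficients of negative index of `conj
  -- f`, so only the index `0` survives.
  have hc : ∀ k, fourierCoeff f k = fourierCoeff (fun _ : TorusT => fourierCoeff f 0) k := by
    intro k
    rw [fourierCoeff_const]
    rcases lt_trichotomy k 0 with hk | rfl | hk
    · rw [hf.2 k hk, if_neg hk.ne]
    · rw [if_pos rfl]
    · rw [if_neg hk.ne']
      have h := hf'.2 (-k) (by omega)
      rw [← map_eq_zero (starRingEnd ℂ), ← h]
      simp only [fourierCoeff]
      rw [← integral_conj]
      congr 1
      funext t
      simp only [smul_eq_mul, map_mul, neg_neg, ← fourier_neg]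
  have hk : MemLp (fun _ : TorusT => fourierCoeff f 0) 2 haarAddCircle := memLp_const _
  have h : hf.1.toLp f = hk.toLp _ := by
    refine (fourierBasis (T := 2 * Real.pi)).repr.injective ?_
    ext i
    rw [fourierBasis_repr, fourierBasis_repr, fourierCoeff_congr_ae hf.1.coeFn_toLp,
      fourierCoeff_congr_ae hk.coeFn_toLp, hc]
  exact (MemLp.toLp_eq_toLp_iff hf.1 hk).1 h

lemma MemHardy.conj_neg (hf : MemHardy p f) : MemHardy p (fun t => conj (f (-t))) := by
  refine ⟨?_, fun k hk => by rw [fourierCoeff_conj_neg, hf.2 k hk, map_zero]⟩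
  have h := hf.1.comp_measurePreserving (Measure.measurePreserving_neg haarAddCircle)
  exact MemLp.of_le h (Complex.continuous_conj.comp_aestronglyMeasurable h.1)
    (.of_forall fun t => by simp)

lemma diskValue_conj_neg (f : TorusT → ℂ) (α : ℂ) :
    diskValue (fun t => conj (f (-t))) α = conj (diskValue f (conj α)) := by
  simp only [diskValue, fourierCoeff_conj_neg, Complex.conj_tsum, map_mul, map_pow,
    Complex.conj_conj]

end Hardy

/-! ### Blaschke factors and division by them. -/

section Blaschke

variable {f : TorusT → ℂ} {a : ℂ}

/-- The Blaschke factor vanishing at `a`. -/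
def blaschkeFactor (a : ℂ) (t : TorusT) : ℂ :=
  ((toCircle t : ℂ) - a) / (1 - conj a * (toCircle t : ℂ))

lemma toCircle_sub_ne_zero (ha : ‖a‖ < 1) (t : TorusT) : (toCircle t : ℂ) - a ≠ 0 := by
  intro h
  have : ‖(toCircle t : ℂ)‖ = ‖a‖ := by rw [sub_eq_zero.1 h]
  rw [Circle.norm_coe] at this
  linarith

lemma one_sub_mul_toCircle (a : ℂ) (t : TorusT) :
    1 - conj a * (toCircle t : ℂ) = (toCircle t : ℂ) * conj ((toCircle t : ℂ) - a) := by
  have h : (toCircle t : ℂ) * conj (toCircle t : ℂ) = 1 := by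
    rw [Complex.mul_conj]; simp
  rw [map_sub, mul_sub, h]
  ring

lemma one_sub_mul_toCircle_ne_zero (ha : ‖a‖ < 1) (t : TorusT) :
    1 - conj a * (toCircle t : ℂ) ≠ 0 := by
  rw [one_sub_mul_toCircle]
  exact mul_ne_zero (Circle.coe_ne_zero _)
    ((map_ne_zero (starRingEnd ℂ)).2 (toCircle_sub_ne_zero ha t))

lemma norm_blaschkeFactor (ha : ‖a‖ < 1) (t : TorusT) : ‖blaschkeFactor a t‖ = 1 := by
  rw [blaschkeFactor, one_sub_mul_toCircle, norm_div, norm_mul, Circle.norm_coe, one_mul,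
    Complex.norm_conj, div_self (norm_ne_zero_iff.2 (toCircle_sub_ne_zero ha t))]

lemma conj_mul_blaschkeFactor (ha : ‖a‖ < 1) (t : TorusT) :
    conj (blaschkeFactor a t) * blaschkeFactor a t = 1 := by
  rw [Complex.conj_mul', norm_blaschkeFactor ha]
  simp

lemma continuous_toCircle_coe : Continuous fun t : TorusT => (toCircle t : ℂ) :=
  continuous_subtype_val.comp continuous_toCircle

lemma continuous_blaschkeFactor (ha : ‖a‖ < 1) : Continuous (blaschkeFactor a) :=
  (continuous_toCircle_coe.sub continuous_const).div
    (continuous_const.sub (continuous_const.mul continuous_toCircle_coe))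
    (one_sub_mul_toCircle_ne_zero ha)

lemma Continuous.memLp_torus {p : ℝ≥0∞} (hf : Continuous f) : MemLp f p haarAddCircle := by
  obtain ⟨C, hC⟩ := (isCompact_range hf).isBounded.exists_norm_le
  exact MemLp.of_bound hf.aestronglyMeasurable C (.of_forall fun t => hC _ ⟨t, rfl⟩)

/-- From `(1 - conj a * z) * h = 1`, the coefficients at `k < 0` satisfy `ĥ(k) = conj a * ĥ(k - 1)`.
Iterating towards `-∞` bounds `|ĥ(k)|` by `|a| ^ n` times the `L¹` norm of `h`, for every `n`. -/
lemma memHardy_inv_one_sub {p : ℝ≥0∞} (ha : ‖a‖ < 1) :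
    MemHardy p (fun t => (1 - conj a * (toCircle t : ℂ))⁻¹) := by
  set h : TorusT → ℂ := fun t => (1 - conj a * (toCircle t : ℂ))⁻¹ with hh
  have hc : Continuous h :=
    (continuous_const.sub (continuous_const.mul continuous_toCircle_coe)).inv₀
      (one_sub_mul_toCircle_ne_zero ha)
  have hi : Integrable h haarAddCircle := hc.memLp_torus.integrable le_rfl
  refine ⟨hc.memLp_torus, fun k hk => ?_⟩
  have hrec : ∀ k : ℤ, k < 0 → fourierCoeff h k = conj a * fourierCoeff h (k - 1) := by
    intro k hk
    rw [← sub_eq_zero, ← fourierCoeff_one_sub_mul hi]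
    have : (fun t => (1 - conj a * (toCircle t : ℂ)) * h t) = fun _ => (1 : ℂ) := by
      funext t
      exact mul_inv_cancel₀ (one_sub_mul_toCircle_ne_zero ha t)
    rw [this, fourierCoeff_const, if_neg hk.ne]
  have hpow : ∀ n : ℕ, fourierCoeff h k = conj a ^ n * fourierCoeff h (k - n) := by
    intro n
    induction n with
    | zero => simp
    | succ n ih =>
      rw [ih, hrec (k - n) (by omega), pow_succ]
      push_cast
      rw [sub_sub]
      ring
  have hlim : Filter.Tendsto (fun n : ℕ =>
      ‖a‖ ^ n * ∫ t, ‖h t‖ ∂(haarAddCircle : Measure TorusT)) Filter.atTop (nhds 0) := by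
    simpa using (tendsto_pow_atTop_nhds_zero_of_lt_one (norm_nonneg a) ha).mul_const
      (∫ t, ‖h t‖ ∂(haarAddCircle : Measure TorusT))
  refine norm_le_zero_iff.1 (ge_of_tendsto' hlim fun n => ?_)
  rw [hpow n, norm_mul, norm_pow, Complex.norm_conj]
  gcongr
  exact norm_fourierCoeff_le _

lemma memHardy_blaschkeFactor {p : ℝ≥0∞} (ha : ‖a‖ < 1) : MemHardy p (blaschkeFactor a) := by
  have h := memHardy_inv_one_sub (p := 2) ha
  refine ⟨(continuous_blaschkeFactor ha).memLp_torus, fun k hk => ?_⟩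
  have := fourierCoeff_toCircle_sub_mul h.integrable a k
  rw [h.2 _ (by omega), h.2 k hk, mul_zero, sub_zero] at this
  exact this

lemma diskValue_blaschkeFactor (ha : ‖a‖ < 1) : diskValue (blaschkeFactor a) a = 0 := by
  have h := memHardy_inv_one_sub (p := 2) ha
  exact (diskValue_toCircle_sub_mul h.integrable ha).trans (h.2 _ (by norm_num))

/-- A function of `H²` vanishing at `a` is divisible by the Blaschke factor of `a`. -/
lemma MemHardy.conj_blaschkeFactor_mul (hf : MemHardy 2 f) (ha : ‖a‖ < 1)
    (hfa : diskValue f a = 0) :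
    MemHardy 2 (fun t => conj (blaschkeFactor a t) * f t) := by
  have hinv : Continuous fun t : TorusT => ((toCircle t : ℂ) - a)⁻¹ :=
    (continuous_toCircle_coe.sub continuous_const).inv₀ (toCircle_sub_ne_zero ha)
  -- `h = f / (z - a)` is in `L²` because the pole lies off the circle. The hypothesis `f(a) = 0`
  -- says `ĥ(-1) = 0`, and the recursion `hrec` carries this down to all negative indices.
  set h : TorusT → ℂ := fun t => ((toCircle t : ℂ) - a)⁻¹ * f t with hh
  have hL : MemLp h 2 haarAddCircle := hf.1.mul (hinv.memLp_torus (p := ∞))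
  have hi : Integrable h haarAddCircle := hL.integrable (by norm_num)
  have hfh : (fun t => ((toCircle t : ℂ) - a) * h t) = f := by
    funext t
    exact mul_inv_cancel_left₀ (toCircle_sub_ne_zero ha t) _
  have hrec : ∀ k, fourierCoeff h (k - 1) - a * fourierCoeff h k = fourierCoeff f k := by
    intro k
    rw [← fourierCoeff_toCircle_sub_mul hi, hfh]
  have h1 : fourierCoeff h (-1) = 0 := by
    rw [← diskValue_toCircle_sub_mul hi ha, hfh, hfa]
  have hneg : ∀ n : ℕ, fourierCoeff h (-1 - n) = 0 := by
    intro n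
    induction n with
    | zero => simpa using h1
    | succ n ih =>
      have := hrec (-1 - n)
      rw [ih, hf.2 _ (by omega), mul_zero, sub_zero] at this
      rw [← this]
      congr 1
      push_cast
      ring
  have hH : ∀ k : ℤ, k < 0 → fourierCoeff h k = 0 := by
    intro k hk
    have := hneg (-1 - k).toNat
    rwa [Int.toNat_of_nonneg (by omega), sub_sub_cancel] at this
  have hb : (fun t => conj (blaschkeFactor a t) * f t) =
      fun t => (1 - conj a * (toCircle t : ℂ)) * h t := by
    funext t
    have h2 := conj_mul_blaschkeFactor ha t
    have h3 := toCircle_sub_ne_zero ha t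
    have h4 := one_sub_mul_toCircle_ne_zero ha t
    have h5 : conj (blaschkeFactor a t) =
        (1 - conj a * (toCircle t : ℂ)) * ((toCircle t : ℂ) - a)⁻¹ := by
      rw [eq_inv_of_mul_eq_one_left h2, blaschkeFactor, inv_div, div_eq_mul_inv]
    rw [h5, hh]
    ring
  rw [hb]
  refine ⟨hL.mul ((continuous_const.sub
    (continuous_const.mul continuous_toCircle_coe)).memLp_torus (p := ∞)), fun k hk => ?_⟩
  rw [fourierCoeff_one_sub_mul hi, hH k hk, hH _ (by omega), mul_zero, sub_zero]

end Blaschke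
-- Matrix-valued Hardy functions.
section HardyMatrices

variable {n m r : ℕ}

lemma MemHardyMat.two {Φ : MatFun n m} (h : MemHardyMat ∞ Φ) : MemHardyMat 2 Φ :=
  fun i j => (h i j).two

lemma memHardyMat_const {p : ℝ≥0∞} (M : Matrix (Fin n) (Fin m) ℂ) :
    MemHardyMat p (fun _ => M : MatFun n m) :=
  fun _ _ => memHardy_const _

lemma diskValueMat_const (M : Matrix (Fin n) (Fin m) ℂ) (α : ℂ) :
    diskValueMat (fun _ => M : MatFun n m) α = M := by
  ext i j
  exact diskValue_const _ α

lemma diskValueMat_congr {Φ Ψ : MatFun n m}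
    (h : ∀ᵐ t ∂(haarAddCircle : Measure TorusT), Φ t = Ψ t) :
    diskValueMat Φ = diskValueMat Ψ := by
  funext α
  ext i j
  refine congrFun (diskValue_congr ?_) α
  filter_upwards [h] with t ht
  rw [ht]

lemma MemHardyMat.mul {Φ : MatFun n m} {Ψ : MatFun m r} (hΦ : MemHardyMat ∞ Φ)
    (hΨ : MemHardyMat 2 Ψ) : MemHardyMat 2 (fun t => Φ t * Ψ t : MatFun n r) := by
  intro i k
  simp only [Matrix.mul_apply]
  exact MemHardy.sum (by norm_num) _ fun j _ => (hΦ i j).mul_bounded le_rfl (hΨ j k)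

lemma diskValueMat_mul {Φ : MatFun n m} {Ψ : MatFun m r} (hΦ : MemHardyMat 2 Φ)
    (hΨ : MemHardyMat 2 Ψ) {α : ℂ} (hα : ‖α‖ < 1) :
    diskValueMat (fun t => Φ t * Ψ t : MatFun n r) α = diskValueMat Φ α * diskValueMat Ψ α := by
  ext i k
  simp only [diskValueMat, Matrix.of_apply, Matrix.mul_apply]
  rw [diskValue_sum _ (F := fun j t => Φ t i j * Ψ t j k)
    (fun j _ => (hΦ i j).1.integrable_mul (hΨ j k).1) hα]
  exact Finset.sum_congr rfl fun j _ => diskValue_mul (hΦ i j) (hΨ j k) hα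

lemma scalarMat_apply (θ : TorusT → ℂ) (t : TorusT) (i j : Fin n) :
    scalarMat n θ t i j = (1 : Matrix (Fin n) (Fin n) ℂ) i j * θ t := by
  simp [scalarMat, mul_comm]

lemma MemHardy.scalarMat {p : ℝ≥0∞} {θ : TorusT → ℂ} (h : MemHardy p θ) :
    MemHardyMat p (scalarMat n θ) := by
  intro i j
  simp only [scalarMat_apply]
  exact h.const_mul _

lemma diskValueMat_scalarMat (θ : TorusT → ℂ) (α : ℂ) :
    diskValueMat (scalarMat n θ) α = diskValue θ α • 1 := by
  ext i j
  simp only [diskValueMat, Matrix.of_apply, scalarMat_apply, diskValue, fourierCoeff.const_mul,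
    Matrix.smul_apply, smul_eq_mul, mul_assoc, tsum_mul_left]
  exact mul_comm _ _

/-- A matrix function of `H²` vanishing at `a` is divisible by the Blaschke factor of `a`. -/
lemma MemHardyMat.conj_blaschkeFactor_smul {Φ : MatFun n m} (hΦ : MemHardyMat 2 Φ) {a : ℂ}
    (ha : ‖a‖ < 1) (h : diskValueMat Φ a = 0) :
    MemHardyMat 2 (fun t => conj (blaschkeFactor a t) • Φ t : MatFun n m) :=
  fun i j => (hΦ i j).conj_blaschkeFactor_mul ha (congrFun (congrFun h i) j)

lemma MemHardyMat.add {Φ Ψ : MatFun n m} (hΦ : MemHardyMat 2 Φ) (hΨ : MemHardyMat 2 Ψ) :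
    MemHardyMat 2 (fun t => Φ t + Ψ t : MatFun n m) :=
  fun i j => (hΦ i j).add (by norm_num) (hΨ i j)

end HardyMatrices

/-! ### Finite Blaschke products: invertibility at the zeros implies left coprimeness. -/

section FiniteBlaschke

variable {n : ℕ}

lemma memHardy_prod_blaschkeFactor (ν : ℂ) {N : ℕ} {a : Fin N → ℂ} (ha : ∀ j, ‖a j‖ < 1) :
    MemHardy ∞ (fun t => ν * ∏ j, blaschkeFactor (a j) t) := by
  refine MemHardy.const_mul ?_ ν
  induction N with
  | zero => simpa using memHardy_const 1
  | succ N ih =>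
    simp only [Fin.prod_univ_succ]
    exact (memHardy_blaschkeFactor (ha 0)).mul_bounded le_top (ih fun j => ha j.succ)

lemma norm_prod_blaschkeFactor {ν : ℂ} (hν : ‖ν‖ = 1) {N : ℕ} {a : Fin N → ℂ}
    (ha : ∀ j, ‖a j‖ < 1) (t : TorusT) : ‖ν * ∏ j, blaschkeFactor (a j) t‖ = 1 := by
  simp [norm_prod, hν, norm_blaschkeFactor (ha _)]

lemma diskValue_prod_blaschkeFactor (ν : ℂ) {N : ℕ} {a : Fin N → ℂ} (ha : ∀ j, ‖a j‖ < 1)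
    {α : ℂ} (hα : ‖α‖ < 1) :
    diskValue (fun t => ν * ∏ j, blaschkeFactor (a j) t) α =
      ν * ∏ j, diskValue (blaschkeFactor (a j)) α := by
  have h1 := fun (N : ℕ) (a : Fin N → ℂ) (ha : ∀ j, ‖a j‖ < 1) =>
    memHardy_prod_blaschkeFactor 1 ha
  simp only [one_mul] at h1
  rw [diskValue_mul (memHardy_const ν) (h1 N a ha).two hα, diskValue_const]
  congr 1
  induction N with
  | zero => simpa using diskValue_const 1 α
  | succ N ih =>
    simp only [Fin.prod_univ_succ]
    rw [diskValue_mul (memHardy_blaschkeFactor (ha 0)) (h1 N _ fun j => ha j.succ).two hα,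
      ih fun j => ha j.succ]

/-- If `Δ` is invertible at the zeros of a finite Blaschke product, then the Blaschke product can
be cancelled from a right factor of `Δ`. -/
lemma exists_mul_eq_const_of_isUnit_diskValueMat {Δ : MatFun n n} (hΔ : MemHardyMat ∞ Δ) (ν : ℂ)
    {N : ℕ} {a : Fin N → ℂ} (ha : ∀ j, ‖a j‖ < 1) (hu : ∀ j, IsUnit (diskValueMat Δ (a j)))
    {A : MatFun n n} (hA : MemHardyMat 2 A)
    (h : ∀ᵐ t ∂(haarAddCircle : Measure TorusT),
      Δ t * A t = scalarMat n (fun t => ν * ∏ j, blaschkeFactor (a j) t) t) :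
    ∃ A' : MatFun n n, MemHardyMat 2 A' ∧
      ∀ᵐ t ∂(haarAddCircle : Measure TorusT), Δ t * A' t = ν • 1 := by
  induction N generalizing A with
  | zero => exact ⟨A, hA, by simpa [scalarMat] using h⟩
  | succ N ih =>
    -- At `a 0` the identity `h` reads `Δ(a 0) A(a 0) = 0`, with `Δ(a 0)` invertible.
    have hA0 : diskValueMat A (a 0) = 0 := by
      have h1 := congrFun (diskValueMat_congr h) (a 0)
      rw [diskValueMat_mul hΔ.two hA (ha 0), diskValueMat_scalarMat,
        diskValue_prod_blaschkeFactor ν ha (ha 0), Fin.prod_univ_succ,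
        diskValue_blaschkeFactor (ha 0), zero_mul, mul_zero, zero_smul] at h1
      exact (hu 0).mul_right_eq_zero.1 h1
    refine ih (fun j => ha j.succ) (fun j => hu j.succ)
      (hA.conj_blaschkeFactor_smul (ha 0) hA0) ?_
    filter_upwards [h] with t ht
    rw [Matrix.mul_smul, ht, scalarMat, scalarMat, smul_smul, Fin.prod_univ_succ]
    congr 1
    linear_combination (ν * ∏ j : Fin N, blaschkeFactor (a j.succ) t) *
      conj_mul_blaschkeFactor (ha 0) t

/-- If `B` is invertible at the zeros of a finite Blaschke product `θ`, then `B` and `θ I` are left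
coprime. -/
theorem leftCoprimeMat_scalarMat_of_isUnit {B : MatFun n n} {θ : TorusT → ℂ}
    (hθ : IsFiniteBlaschkeProduct θ) (h : ∀ α ∈ diskZeros θ, IsUnit (diskValueMat B α)) :
    LeftCoprimeMat B (scalarMat n θ) := by
  obtain ⟨N, ν, a, hν, ha, hθa⟩ := hθ
  change ∀ᵐ t ∂(haarAddCircle : Measure TorusT),
    θ t = (fun t => ν * ∏ j, blaschkeFactor (a j) t) t at hθa
  rintro m Δ ⟨hmn, ⟨hΔ, hΔ1⟩, C, hC, hBC⟩ ⟨-, -, A, hA, hΘA⟩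
  have hΔA : ∀ᵐ t ∂(haarAddCircle : Measure TorusT),
      Δ t * A t = scalarMat n (fun t => ν * ∏ j, blaschkeFactor (a j) t) t := by
    filter_upwards [hθa, hΘA] with t h1 h2
    rw [← h2, scalarMat, scalarMat, h1]
  -- At a point of the circle where `Δ A = θ I`, the right side has rank `n` because `|θ| = 1`,
  -- while the left side has rank at most `m`.
  obtain rfl : m = n := by
    obtain ⟨t, ht⟩ := hΔA.exists
    refine le_antisymm hmn ?_
    have h1 : (Δ t * A t).rank = n := by
      rw [ht, scalarMat, Matrix.rank_smul_of_mem_nonZeroDivisors, Matrix.rank_one,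
        Fintype.card_fin]
      refine mem_nonZeroDivisors_of_ne_zero fun h0 => ?_
      simpa [h0] using norm_prod_blaschkeFactor hν ha t
    have h2 := (Matrix.rank_mul_le_left (Δ t) (A t)).trans (Matrix.rank_le_width (Δ t))
    omega
  obtain ⟨A', hA', hΔA'⟩ := exists_mul_eq_const_of_isUnit_diskValueMat hΔ ν ha (fun j => by
    have h1 : IsUnit (diskValueMat B (a j)) := h _ ⟨ha j, by
      rw [diskValue_congr hθa, diskValue_prod_blaschkeFactor ν ha (ha j),
        Finset.prod_eq_zero (Finset.mem_univ j) (diskValue_blaschkeFactor (ha j)), mul_zero]⟩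
    rw [diskValueMat_congr hBC, diskValueMat_mul hΔ.two hC (ha j),
      Matrix.isUnit_iff_isUnit_det, Matrix.det_mul] at h1
    exact (Matrix.isUnit_iff_isUnit_det _).2 (isUnit_of_mul_isUnit_left h1)) hA hΔA
  have hν0 : ν ≠ 0 := by
    rintro rfl
    simp at hν
  -- Multiplying `Δ A' = ν I` by `Δ*` gives `A' = ν Δ*`, so the conjugated entries of `Δ` are
  -- entries of `ν⁻¹ A'`.
  have hconj : ∀ i j, MemHardy 2 (fun t => conj (Δ t i j)) := by
    intro i j
    refine ((hA' j i).const_mul ν⁻¹).congr ?_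
    filter_upwards [hΔ1, hΔA'] with t h1 h2
    have h3 : A' t = ν • (Δ t)ᴴ := by
      rw [← one_mul (A' t), ← h1, Matrix.mul_assoc, h2, Matrix.mul_smul, Matrix.mul_one]
    rw [h3, Matrix.smul_apply, smul_eq_mul, inv_mul_cancel_left₀ hν0, Matrix.conjTranspose_apply]
    rfl
  have hconst : ∀ᵐ t ∂(haarAddCircle : Measure TorusT),
      Δ t = Matrix.of fun i j => fourierCoeff (fun t => Δ t i j) 0 := by
    have := ae_all_iff.2 fun i => ae_all_iff.2 fun j => (hΔ.two i j).ae_eq_const (hconj i j)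
    filter_upwards [this] with t ht
    ext i j
    exact ht i j
  obtain ⟨t, h1, h2⟩ := (hΔ1.and hconst).exists
  rw [h2] at h1
  exact ⟨_, h1, mul_eq_one_comm.1 h1, hconst⟩

end FiniteBlaschke

/-! ### Blaschke–Potapov factors: left coprimeness implies invertibility at the zeros. -/

section BlaschkePotapov

variable {n : ℕ}

open scoped ComplexOrder in
/-- A singular square matrix is annihilated from the left by a nonzero orthogonal projection. -/
lemma exists_projection_mul_eq_zero {M : Matrix (Fin n) (Fin n) ℂ} (hM : ¬ IsUnit M) :
    ∃ P : Matrix (Fin n) (Fin n) ℂ, Pᴴ = P ∧ P * P = P ∧ P ≠ 0 ∧ P * M = 0 := by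
  rw [Matrix.isUnit_iff_isUnit_det, isUnit_iff_ne_zero, not_not,
    ← Matrix.exists_vecMul_eq_zero_iff] at hM
  obtain ⟨v, hv, hvM⟩ := hM
  have hc : v ⬝ᵥ star v ≠ 0 := by
    rwa [Ne, dotProduct_self_star_eq_zero]
  have hcs : star (v ⬝ᵥ star v) = v ⬝ᵥ star v := by
    rw [← Matrix.star_dotProduct_star, star_star]
  -- With `v` a row vector killing `M` from the left, this is the rank-one projection `v* v / (v
  -- v*)`.
  refine ⟨(v ⬝ᵥ star v)⁻¹ • Matrix.vecMulVec (star v) v, ?_, ?_, ?_, ?_⟩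
  · rw [Matrix.conjTranspose_smul, Matrix.conjTranspose_vecMulVec, star_star, star_inv₀, hcs]
  · rw [Matrix.smul_mul, Matrix.mul_smul, Matrix.vecMulVec_mul_vecMulVec, Matrix.vecMulVec_smul,
      smul_smul, smul_smul, mul_assoc, inv_mul_cancel₀ hc, mul_one]
  · rw [Ne, smul_eq_zero, Matrix.vecMulVec_eq_zero, star_eq_zero]
    exact not_or.2 ⟨inv_ne_zero hc, not_or.2 ⟨hv, hv⟩⟩
  · rw [Matrix.smul_mul, Matrix.vecMulVec_mul, hvM]
    simp

/-- The Blaschke–Potapov factor `b P + (I - P)` with `b` the Blaschke factor of `a`. -/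
def potapovFactor (a : ℂ) (P : Matrix (Fin n) (Fin n) ℂ) : MatFun n n :=
  fun t => blaschkeFactor a t • P + (1 - P)

variable {a : ℂ} {P : Matrix (Fin n) (Fin n) ℂ}

lemma conjTranspose_potapovFactor (hP : Pᴴ = P) (t : TorusT) :
    (potapovFactor a P t)ᴴ = conj (blaschkeFactor a t) • P + (1 - P) := by
  simp [potapovFactor, hP]

lemma isInnerMat_potapovFactor (ha : ‖a‖ < 1) (hP : Pᴴ = P) (hPP : P * P = P) :
    IsInnerMat (potapovFactor a P) := by
  refine ⟨fun i j => ?_, .of_forall fun t => ?_⟩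
  · have := ((memHardy_blaschkeFactor (p := ∞) ha).const_mul (P i j)).add le_top
      (memHardy_const ((1 - P) i j))
    simpa [potapovFactor, mul_comm] using this
  · rw [conjTranspose_potapovFactor hP, potapovFactor]
    simp only [add_mul, mul_add, Matrix.smul_mul, Matrix.mul_smul, mul_sub, sub_mul, hPP, mul_one,
      one_mul, smul_smul, mul_comm (blaschkeFactor a t), conj_mul_blaschkeFactor ha]
    simp

/-- The factor is unitary on the circle, so the quotient must be its adjoint times `Φ`, namely `conj
b • P Φ + (1 - P) Φ`. Only the first term could leave `H²`, and `P Φ` vanishes at `a`. -/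
lemma isLeftInnerDivisor_potapovFactor (ha : ‖a‖ < 1) (hP : Pᴴ = P) (hPP : P * P = P) {r : ℕ}
    {Φ : MatFun n r} (hΦ : MemHardyMat 2 Φ) (h : P * diskValueMat Φ a = 0) :
    IsLeftInnerDivisor (potapovFactor a P) Φ := by
  have hin := isInnerMat_potapovFactor ha hP hPP
  refine ⟨le_rfl, hin, fun t => conj (blaschkeFactor a t) • (P * Φ t) + (1 - P) * Φ t, ?_, ?_⟩
  · refine MemHardyMat.add (MemHardyMat.conj_blaschkeFactor_smul
      ((memHardyMat_const P).mul hΦ) ha ?_) ((memHardyMat_const (1 - P)).mul hΦ)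
    rw [diskValueMat_mul (memHardyMat_const P) hΦ ha, diskValueMat_const, h]
  · filter_upwards [hin.2] with t ht
    rw [← Matrix.smul_mul, ← Matrix.add_mul, ← conjTranspose_potapovFactor hP, ← Matrix.mul_assoc,
      mul_eq_one_comm.1 ht, Matrix.one_mul]

/-- Multiplying the factor by `P` gives `b P`, so a constant factor would make `b` constant. But `b`
vanishes at `a` and has modulus `1` on the circle. -/
lemma not_isUnitaryConstant_potapovFactor (ha : ‖a‖ < 1) (hPP : P * P = P) (hP0 : P ≠ 0) :
    ¬ IsUnitaryConstant (potapovFactor a P) := by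
  rintro ⟨U, -, -, hU⟩
  obtain ⟨i, j, hij⟩ : ∃ i j, P i j ≠ 0 := by
    by_contra! h
    exact hP0 (by ext i j; exact h i j)
  have hb : ∀ᵐ t ∂(haarAddCircle : Measure TorusT),
      blaschkeFactor a t = (P * U) i j / P i j := by
    filter_upwards [hU] with t ht
    rw [← ht, potapovFactor, Matrix.mul_add, Matrix.mul_smul, Matrix.mul_sub, hPP, Matrix.mul_one,
      sub_self, add_zero, Matrix.smul_apply, smul_eq_mul, mul_div_cancel_right₀ _ hij]
  have hc := congrFun (diskValue_congr hb) a
  rw [diskValue_blaschkeFactor ha, diskValue_const] at hc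
  obtain ⟨t, ht⟩ := hb.exists
  have := norm_blaschkeFactor ha t
  rw [ht, ← hc] at this
  simp at this

/-- If `B` and `θ I` are left coprime, then `B` is invertible at the zeros of `θ`. -/
theorem isUnit_diskValueMat_of_leftCoprimeMat {B : MatFun n n} (hB : MemHardyMat 2 B)
    {θ : TorusT → ℂ} (hθ : MemHardy 2 θ) (h : LeftCoprimeMat B (scalarMat n θ)) {α : ℂ}
    (hα : α ∈ diskZeros θ) : IsUnit (diskValueMat B α) := by
  by_contra hu
  obtain ⟨P, hP, hPP, hP0, hPB⟩ := exists_projection_mul_eq_zero hu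
  refine not_isUnitaryConstant_potapovFactor hα.1 hPP hP0 (h n _
    (isLeftInnerDivisor_potapovFactor hα.1 hP hPP hB hPB)
    (isLeftInnerDivisor_potapovFactor hα.1 hP hPP hθ.scalarMat ?_))
  rw [diskValueMat_scalarMat, hα.2, zero_smul, Matrix.mul_zero]

lemma IsFiniteBlaschkeProduct.memHardy {θ : TorusT → ℂ} (hθ : IsFiniteBlaschkeProduct θ) :
    MemHardy ∞ θ := by
  obtain ⟨N, ν, a, hν, ha, hθa⟩ := hθ
  refine (memHardy_prod_blaschkeFactor ν ha).congr ?_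
  filter_upwards [hθa] with t ht
  exact ht.symm

theorem isUnit_diskValueMat_iff_leftCoprimeMat {B : MatFun n n} (hB : MemHardyMat 2 B)
    {θ : TorusT → ℂ} (hθ : IsFiniteBlaschkeProduct θ) :
    (∀ α ∈ diskZeros θ, IsUnit (diskValueMat B α)) ↔ LeftCoprimeMat B (scalarMat n θ) :=
  ⟨leftCoprimeMat_scalarMat_of_isUnit hθ,
    fun h _ => isUnit_diskValueMat_of_leftCoprimeMat hB hθ.memHardy.two h⟩

end BlaschkePotapov

/-! ### The tilde operation and the passage to right coprimeness. -/

section Tilde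

variable {n m : ℕ}

lemma MemHardyMat.tildeMat {p : ℝ≥0∞} {Φ : MatFun n m} (hΦ : MemHardyMat p Φ) :
    MemHardyMat p (tildeMat Φ) :=
  fun i j => (hΦ j i).conj_neg

lemma diskValueMat_tildeMat (Φ : MatFun n m) (α : ℂ) :
    diskValueMat (tildeMat Φ) α = (diskValueMat Φ (conj α))ᴴ := by
  ext i j
  exact diskValue_conj_neg (fun t => Φ t j i) α

lemma tildeMat_scalarMat (θ : TorusT → ℂ) :
    tildeMat (scalarMat n θ) = scalarMat n (fun t => conj (θ (-t))) := by
  funext t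
  simp [tildeMat, scalarMat]

lemma ae_comp_neg_torus {q : TorusT → Prop}
    (h : ∀ᵐ t ∂(haarAddCircle : Measure TorusT), q t) :
    ∀ᵐ t ∂(haarAddCircle : Measure TorusT), q (-t) :=
  (Measure.measurePreserving_neg (haarAddCircle : Measure TorusT)).quasiMeasurePreserving.ae h

lemma IsFiniteBlaschkeProduct.conj_neg {θ : TorusT → ℂ} (hθ : IsFiniteBlaschkeProduct θ) :
    IsFiniteBlaschkeProduct (fun t => conj (θ (-t))) := by
  obtain ⟨N, ν, a, hν, ha, hθa⟩ := hθ
  refine ⟨N, conj ν, fun j => conj (a j), by simpa using hν, fun j => by simpa using ha j, ?_⟩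
  filter_upwards [ae_comp_neg_torus hθa] with t ht
  rw [ht]
  simp [toCircle_neg, ← Circle.coe_inv_eq_conj]

/-- Conjugation exchanges the two zero sets, and a matrix is invertible exactly when its adjoint is.
-/
lemma isUnit_diskValueMat_tildeMat_iff (B : MatFun n n) (θ : TorusT → ℂ) :
    (∀ α ∈ diskZeros (fun t => conj (θ (-t))), IsUnit (diskValueMat (tildeMat B) α)) ↔
      ∀ α ∈ diskZeros θ, IsUnit (diskValueMat B α) := by
  simp only [diskValueMat_tildeMat, diskZeros, diskValue_conj_neg, map_eq_zero, Set.mem_ofPred_eq,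
    ← Matrix.star_eq_conjTranspose, isUnit_star]
  constructor
  · intro h α hα
    simpa using h (conj α) (by simpa using hα)
  · intro h α hα
    exact h (conj α) (by simpa using hα)

end Tilde
end

theorem lemma3p12 (n : ℕ) (B : MatFun n n) (hB : MemHardyMat 2 B)
    (θ : TorusT → ℂ) (hθ : IsFiniteBlaschkeProduct θ) :
    List.TFAE
      [∀ α ∈ diskZeros θ, IsUnit (diskValueMat B α),
        RightCoprimeMat B (scalarMat n θ),
        LeftCoprimeMat B (scalarMat n θ)] := by
  tfae_have 1 ↔ 3 := isUnit_diskValueMat_iff_leftCoprimeMat hB hθ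
  tfae_have 1 ↔ 2 := by
    rw [RightCoprimeMat, tildeMat_scalarMat,
      ← isUnit_diskValueMat_iff_leftCoprimeMat hB.tildeMat hθ.conj_neg,
      isUnit_diskValueMat_tildeMat_iff]
  tfae_finish
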